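/- **Theorem (Jacobi–Trudi formulas for Schur type quasi-symmetric functions).** Let $\mathbb{N}$ be the set of positive integers and let $t_1,t_2,\ldots$ be variables. For a finite sequence ${\pmb\gamma}=(\gamma_1,\ldots,\gamma_n)$ of positive integers let $$E_{\pmb\gamma}=\sum_{m_1\le m_2\le\cdots\le m_n}t_{m_1}^{\gamma_1}\cdots t_{m_n}^{\gamma_n},\qquad M_{\pmb\gamma}=\sum_{m_1<m_2<\cdots<m_n}t_{m_1}^{\gamma_1}\cdots t_{m_n}^{\gamma_n}$$ be the essential and the monomial quasi-symmetric functions, as elements of $\mathbb{Z}[\![t_1,t_2,\ldots]\!]$. Let $r,s\ge 0$ be integers and let $\mu\subset\lambda\subset(s^r)$ be partitions, written $\lambda=(\lambda_1,\ldots,\lambda_r)$, $\mu=(\mu_1,\ldots,\mu_r)$ with zero parts allowed, with conjugates $\lambda'=(\lambda'_1,\ldots,\lambda'_s)$, $\mu'=(\mu'_1,\ldots,\mu'_s)$. Let $D(\lambda/\mu)=\{(i,j)\mid 1\le i\le r,\ \mu_i<j\le\lambda_i\}$. For a filling ${\pmb\gamma}=(\gamma_{ij})_{(i,j)\in D(\lambda/\mu)}$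 by positive integers let $$S_{\lambda/\mu}({\pmb\gamma})=\sum_{(m_{ij})\in\mathrm{SSYT}(\lambda/\mu)}\ \prod_{(i,j)\in D(\lambda/\mu)}t_{m_{ij}}^{\gamma_{ij}},$$ where $\mathrm{SSYT}(\lambda/\mu)$ is the set of fillings $(m_{ij})$ of $D(\lambda/\mu)$ by positive integers that weakly increase from left to right along rows and strictly increase from top to bottom along columns. Assume that ${\pmb\gamma}\in T^{\mathrm{diag}}(\lambda/\mu,\mathbb{N})$, that is, $\gamma_{ij}=\gamma_{kl}$ whenever $j-i=l-k$, and let $(c_k)_{k\in\mathbb{Z}}$ be positive integers with $c_k=\gamma_{i,i+k}$ whenever $(i,i+k)\in D(\lambda/\mu)$ (the other $c_k$ may be chosen arbitrarily). Then the following identities hold in $\mathbb{Z}[\![t_1,t_2,\ldots]\!]$. (1) $$S_{\lambda/\mu}({\pmb\gamma})=\det\left[E_{(c_{\mu_j-j+1},\,c_{\mu_j-j+2},\,\ldots,\,c_{\mu_j-j+(\lambda_i-\mu_j-i+j)})}\right]_{1\le i,j\le r},$$ where $E_{(\cdots)}$ is understood as $1$ if $\lambda_i-\mu_j-i+j=0$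 and as $0$ if $\lambda_i-\mu_j-i+j<0$. (2) $$S_{\lambda/\mu}({\pmb\gamma})=\det\left[M_{(c_{-\mu'_j+j-1},\,c_{-\mu'_j+j-2},\,\ldots,\,c_{-\mu'_j+j-(\lambda'_i-\mu'_j-i+j)})}\right]_{1\le i,j\le s},$$ where $M_{(\cdots)}$ is understood as $1$ if $\lambda'_i-\mu'_j-i+j=0$ and as $0$ if $\lambda'_i-\mu'_j-i+j<0$. -/

import Mathlib

/-- Formal power series in the variables `t₁, t₂, …` with integer coefficients. -/
abbrev PSeries : Type := MvPowerSeries ℕ+ ℤ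

section Sums

open scoped MvPowerSeries.WithPiTopology

/-- The essential quasi-symmetric function
`E_γ = ∑_{m₁ ≤ m₂ ≤ ⋯ ≤ mₙ} t_{m₁}^{γ₁} ⋯ t_{mₙ}^{γₙ}` of a finite sequence `γ` of positive integers.
Infinite sums of power series are taken in the topology of coefficientwise convergence
(`ℤ` being discrete); for `n = 0` the value is `1`. -/
noncomputable def essentialQSym {n : ℕ} (γ : Fin n → ℕ+) : PSeries :=
  ∑' m : {m : Fin n → ℕ+ // Monotone m}, ∏ k, MvPowerSeries.X (m.1 k) ^ (γ k : ℕ)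

/-- The monomial quasi-symmetric function
`M_γ = ∑_{m₁ < m₂ < ⋯ < mₙ} t_{m₁}^{γ₁} ⋯ t_{mₙ}^{γₙ}` of a finite sequence `γ` of positive integers;
for `n = 0` the value is `1`. -/
noncomputable def monomialQSym {n : ℕ} (γ : Fin n → ℕ+) : PSeries :=
  ∑' m : {m : Fin n → ℕ+ // StrictMono m}, ∏ k, MvPowerSeries.X (m.1 k) ^ (γ k : ℕ)

/-- The boxes of the skew diagram `λ/μ`. As everywhere in Mathlib, rows and columns of Young
diagrams are numbered from `0`: the pair `(i, j)` stands for the box in row `i + 1` and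
column `j + 1`. -/
def skewCells (lam mu : YoungDiagram) : Finset (ℕ × ℕ) := lam.cells \ mu.cells

/-- The set `T(λ/μ, X)` of fillings of the boxes of `λ/μ` by elements of `X`. -/
abbrev SkewTableau (lam mu : YoungDiagram) (X : Type*) : Type _ :=
  {x : ℕ × ℕ // x ∈ skewCells lam mu} → X

/-- The content `j - i` of a box in row `i` and column `j`
(the same whether one counts from `0` or from `1`). -/
def content (x : ℕ × ℕ) : ℤ := (x.2 : ℤ) - (x.1 : ℤ)

/-- Membership in `T^diag(λ/μ, X)`: the entries are constant along every diagonal. -/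
def SkewTableau.IsDiagonal {lam mu : YoungDiagram} {X : Type*} (T : SkewTableau lam mu X) : Prop :=
  ∀ x y, content x.1 = content y.1 → T x = T y

/-- Semi-standard fillings of `λ/μ` by positive integers: weakly increasing from left to right
along rows and strictly increasing from top to bottom along columns. -/
def SkewTableau.IsSemistandard {lam mu : YoungDiagram} (T : SkewTableau lam mu ℕ+) : Prop :=
  (∀ x y, x.1.1 = y.1.1 → x.1.2 ≤ y.1.2 → T x ≤ T y) ∧
  (∀ x y, x.1.2 = y.1.2 → x.1.1 < y.1.1 → T x < T y)

/-- The set `SSYT(λ/μ)`. -/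
abbrev SkewSSYT (lam mu : YoungDiagram) : Type :=
  {T : SkewTableau lam mu ℕ+ // T.IsSemistandard}

/-- The Schur type quasi-symmetric function
`S_{λ/μ}(γ) = ∑_{(m_{ij}) ∈ SSYT(λ/μ)} ∏_{(i,j) ∈ D(λ/μ)} t_{m_{ij}}^{γ_{ij}}`. -/
noncomputable def schurQSym (lam mu : YoungDiagram) (γ : SkewTableau lam mu ℕ+) : PSeries :=
  ∑' T : SkewSSYT lam mu, ∏ x, MvPowerSeries.X (T.1 x) ^ (γ x : ℕ)

/-- `E_{(c_a, c_{a+1}, …, c_{a+n-1})}` for an integer length `n`, understood as `0` for `n < 0`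
(and as `1` for `n = 0`). -/
noncomputable def essentialEntry (c : ℤ → ℕ+) (a n : ℤ) : PSeries :=
  if n < 0 then 0 else essentialQSym fun k : Fin n.toNat => c (a + (k : ℕ))

/-- `M_{(c_a, c_{a-1}, …, c_{a-n+1})}` for an integer length `n`, understood as `0` for `n < 0`
(and as `1` for `n = 0`). -/
noncomputable def monomialEntry (c : ℤ → ℕ+) (a n : ℤ) : PSeries :=
  if n < 0 then 0 else monomialQSym fun k : Fin n.toNat => c (a - (k : ℕ))

/-- The sums defining `E_γ`, `M_γ` and `S_{λ/μ}(γ)` are legitimate: in a family of monomials with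
positive exponents `∏ₓ t_{m(x)}^{γ(x)}` indexed by distinct maps `m` on a finite set, every monomial
occurs finitely often. -/
theorem summable_monomials {ι : Type} [Fintype ι] (P : (ι → ℕ+) → Prop) (γ : ι → ℕ+) :
    Summable fun m : {m : ι → ℕ+ // P m} =>
      (∏ x, MvPowerSeries.X (m.1 x) ^ (γ x : ℕ) : PSeries) := by
  classical
  rw [MvPowerSeries.WithPiTopology.summable_iff_summable_coeff]
  intro d
  apply summable_of_hasFiniteSupport
  have key : ∀ m : ι → ℕ+, (∏ x, MvPowerSeries.X (m x) ^ (γ x : ℕ) : PSeries)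
      = MvPowerSeries.monomial (∑ x, Finsupp.single (m x) (γ x : ℕ)) 1 := by
    intro m
    simp only [MvPowerSeries.X_pow_eq, MvPowerSeries.prod_monomial, Finset.prod_const_one]
  have hfin : (Set.pi Set.univ fun _ : ι => (d.support : Set ℕ+)).Finite :=
    Set.Finite.pi fun _ => d.support.finite_toSet
  refine Set.Finite.subset (hfin.preimage (f := fun m : {m : ι → ℕ+ // P m} => m.1)
    Subtype.val_injective.injOn) ?_
  intro m hm
  simp only [Function.mem_support, key, MvPowerSeries.coeff_monomial] at hm
  have hd : d = ∑ x, Finsupp.single (m.1 x) (γ x : ℕ) := by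
    by_contra h
    exact hm (by simp [h])
  simp only [Set.mem_preimage, Set.mem_pi, Set.mem_univ, forall_true_left, Finset.mem_coe,
    Finsupp.mem_support_iff]
  intro x
  have h1 : (γ x : ℕ) ≤ d (m.1 x) := by
    rw [hd, Finsupp.finsetSum_apply]
    calc (γ x : ℕ) = Finsupp.single (m.1 x) (γ x : ℕ) (m.1 x) := by simp
      _ ≤ _ := Finset.single_le_sum
        (f := fun y => Finsupp.single (m.1 y) (γ y : ℕ) (m.1 x)) (fun _ _ => Nat.zero_le _)
        (Finset.mem_univ x)
  have := (γ x).pos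
  omega

theorem essentialEntry_zero (c : ℤ → ℕ+) (a : ℤ) : essentialEntry c a 0 = 1 := by
  have : Unique {m : Fin 0 → ℕ+ // Monotone m} :=
    ⟨⟨⟨Fin.elim0, fun i => i.elim0⟩⟩, fun m => Subtype.ext (funext fun i => i.elim0)⟩
  change (if (0 : ℤ) < 0 then (0 : PSeries) else
    essentialQSym fun k : Fin 0 => c (a + (k : ℕ))) = 1
  simp [essentialQSym]

theorem monomialEntry_zero (c : ℤ → ℕ+) (a : ℤ) : monomialEntry c a 0 = 1 := by
  have : Unique {m : Fin 0 → ℕ+ // StrictMono m} :=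
    ⟨⟨⟨Fin.elim0, fun i => i.elim0⟩⟩, fun m => Subtype.ext (funext fun i => i.elim0)⟩
  change (if (0 : ℤ) < 0 then (0 : PSeries) else
    monomialQSym fun k : Fin 0 => c (a - (k : ℕ))) = 1
  simp [monomialQSym]

end Sums

/-! ### Flagged fillings and the removal of a corner box -/

section Fillings

open Finset

/-! The formulas are proved for entries below a bound `M`, with an arbitrary weight `w v k` for a
box of content `k` and entry `v`, and then `M` tends to infinity. To make induction possible, each
row `i` gets its own bound, the flag `m i`. When `m i = M + 1`, either the last entry of row `i` is
not `M`, and the flag may be lowered, or it is `M`, and the last box may be removed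
(`fillingSum_recurrence`).

A single row with contents `a, …, b - 1` obeys the same recurrence, and its last box has content `b
- 1` whatever `a` is. This is where constancy along diagonals enters: the coefficient is common to a
whole row of the Jacobi–Trudi matrix, so multilinearity gives the determinant the same recurrence
(`flaggedDet_recurrence`). When the box cannot be removed, the extra determinant has two equal rows
or a large block of zeros, hence vanishes.

Raising the flags one row at a time, in an order compatible with the column condition, leads from
the empty alphabet to `M` letters (`flaggedDet_eq_fillingSum_of_update`,
`det_rowSum_eq_fillingSum`). The parameter `δ` covers both formulas: transposing the diagram
exchanges weak and strict inequalities and negates contents. -/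

/-- Fillings of the boxes `(i, j)`, `μ i ≤ j < ν i`, by natural numbers such that the entries of
row `i` are smaller than `m i`. For `δ = 0` rows increase weakly and columns strictly, for `δ = 1`
rows increase strictly and columns weakly. Outside of the boxes the value is `0`. -/
structure IsFlaggedFilling (δ : ℕ) {r : ℕ} (μ ν m : Fin r → ℕ) (T : Fin r → ℕ → ℕ) : Prop where
  zero : ∀ i j, ¬(μ i ≤ j ∧ j < ν i) → T i j = 0
  lt : ∀ i j, μ i ≤ j → j < ν i → T i j < m i
  row : ∀ i j j', μ i ≤ j → j < j' → j' < ν i → T i j + δ ≤ T i j'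
  col : ∀ i i' j, i < i' → μ i ≤ j → j < ν i → μ i' ≤ j → j < ν i' → T i j + 1 ≤ T i' j + δ

variable {R : Type*} [CommRing R]

/-- The weight of a filling: a box of content `k` with entry `v` contributes `w v k`. -/
def fillingWeight (w : ℕ → ℤ → R) {r : ℕ} (μ ν : Fin r → ℕ) (T : Fin r → ℕ → ℕ) : R :=
  ∏ i, ∏ j ∈ Ico (μ i) (ν i), w (T i j) ((j : ℤ) - (i : ℕ))

/-- The generating function of the flagged fillings of `ν/μ`. -/
noncomputable def fillingSum (δ : ℕ) (w : ℕ → ℤ → R) {r : ℕ} (μ ν m : Fin r → ℕ) : R :=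
  ∑ᶠ T ∈ {T | IsFlaggedFilling δ μ ν m T}, fillingWeight w μ ν T

/-- The value `0` outside the boxes leaves finitely many choices for each row. Finiteness is what
allows the sums over fillings to be split and multiplied by constants. -/
theorem finite_isFlaggedFilling (δ : ℕ) {r : ℕ} (μ ν m : Fin r → ℕ) :
    {T | IsFlaggedFilling δ μ ν m T}.Finite := by
  have key : ∀ i, {f : ℕ → ℕ | (∀ j, ν i ≤ j → f j = 0) ∧ ∀ j, f j ≤ m i}.Finite := by
    intro i
    have hfin : (Set.pi Set.univ fun _ : Fin (ν i) => Set.Iic (m i)).Finite :=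
      Set.Finite.pi fun _ => Set.finite_Iic _
    refine Set.Finite.of_finite_image (f := fun (f : ℕ → ℕ) (k : Fin (ν i)) => f k)
      (hfin.subset ?_) ?_
    · rintro _ ⟨f, hf, rfl⟩ k _
      exact hf.2 k
    · intro f hf g hg hfg
      funext j
      by_cases hj : j < ν i
      · exact congrFun hfg ⟨j, hj⟩
      · rw [hf.1 j (not_lt.1 hj), hg.1 j (not_lt.1 hj)]
  refine (Set.Finite.pi key).subset ?_
  intro T hT i _
  refine ⟨fun j hj => hT.zero i j (by omega), fun j => ?_⟩
  by_cases hj : μ i ≤ j ∧ j < ν i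
  · exact (hT.lt i j hj.1 hj.2).le
  · rw [hT.zero i j hj]; exact Nat.zero_le _

theorem fillingSum_update_of_eq (δ : ℕ) (w : ℕ → ℤ → R) {r : ℕ} (μ ν m : Fin r → ℕ) (i : Fin r)
    (h : ν i = μ i) (x : ℕ) :
    fillingSum δ w μ ν (Function.update m i x) = fillingSum δ w μ ν m := by
  have : ∀ T, IsFlaggedFilling δ μ ν (Function.update m i x) T ↔ IsFlaggedFilling δ μ ν m T := by
    intro T
    have hlt : (∀ k j, μ k ≤ j → j < ν k → T k j < Function.update m i x k) ↔
        ∀ k j, μ k ≤ j → j < ν k → T k j < m k := by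
      refine forall_congr' fun k => ?_
      by_cases hk : k = i
      · subst hk
        exact ⟨fun _ j h1 h2 => by omega, fun _ j h1 h2 => by omega⟩
      · rw [Function.update_of_ne hk]
    exact ⟨fun H => ⟨H.zero, hlt.1 H.lt, H.row, H.col⟩, fun H => ⟨H.zero, hlt.2 H.lt, H.row, H.col⟩⟩
  simp only [fillingSum, this]

/-- The value `x` is free because the shortened shape no longer sees column `n` of row `i`. It is
taken to be `0` later, as fillings vanish off their boxes. -/
theorem fillingWeight_eq_mul (w : ℕ → ℤ → R) {r : ℕ} (μ ν : Fin r → ℕ) (T : Fin r → ℕ → ℕ)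
    (i : Fin r) (n : ℕ) (hν : ν i = n + 1) (h : μ i ≤ n) (x : ℕ) :
    fillingWeight w μ ν T = w (T i n) ((n : ℤ) - (i : ℕ)) *
      fillingWeight w μ (Function.update ν i n)
        (Function.update T i (Function.update (T i) n x)) := by
  unfold fillingWeight
  rw [← mul_prod_erase univ _ (mem_univ i),
    ← mul_prod_erase univ (fun k => ∏ j ∈ Ico (μ k) (Function.update ν i n k), _) (mem_univ i),
    ← mul_assoc]
  congr 1
  · simp only [Function.update_self, hν]
    rw [prod_Ico_succ_top h, mul_comm]
    congr 1
    refine prod_congr rfl fun j hj => ?_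
    rw [Function.update_of_ne (by have := mem_Ico.1 hj; omega)]
  · refine prod_congr rfl fun k hk => ?_
    simp only [Function.update_of_ne (ne_of_mem_erase hk)]

/-- The bijection removing the last box of row `i`, when its entry is as large as possible. -/
theorem bijOn_remove_box (δ : ℕ) (hδ : δ ≤ 1) {r : ℕ} (μ ν m : Fin r → ℕ) (i : Fin r) (n M : ℕ)
    (hν : ν i = n + 1) (h : μ i ≤ n) (hm : m i = M + 1)
    (hlt : ∀ k < i, m k ≤ M + δ) (hgt : ∀ k, i < k → ν k ≤ n) :
    Set.BijOn (fun T : Fin r → ℕ → ℕ => Function.update T i (Function.update (T i) n 0))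
      {T | IsFlaggedFilling δ μ ν m T ∧ T i n = M}
      {T | IsFlaggedFilling δ μ (Function.update ν i n) (Function.update m i (M + 1 - δ)) T} := by
  have hle : ∀ k, Function.update ν i n k ≤ ν k := by
    intro k
    rcases eq_or_ne k i with rfl | hk
    · simp [hν]
    · simp [hk]
  have hbox : ∀ (T : Fin r → ℕ → ℕ) (x k j), j < Function.update ν i n k →
      Function.update T i (Function.update (T i) n x) k j = T k j := by
    intro T x k j hj
    rcases eq_or_ne k i with rfl | hk
    · rw [Function.update_self] at hj ⊢
      rw [Function.update_of_ne (by omega)]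
    · rw [Function.update_of_ne hk]
  refine ⟨?_, ?_, ?_⟩
  · rintro T ⟨hT, hTn⟩
    refine ⟨?_, ?_, ?_, ?_⟩
    · intro k j hj
      rcases eq_or_ne k i with rfl | hk
      · simp only [Function.update_self] at hj ⊢
        by_cases hjn : j = n
        · rw [hjn, Function.update_self]
        · rw [Function.update_of_ne hjn]
          exact hT.zero k j (by omega)
      · simp only [Function.update_of_ne hk] at hj ⊢
        exact hT.zero k j hj
    · intro k j h1 h2
      beta_reduce
      rw [hbox T 0 k j h2]
      rcases eq_or_ne k i with rfl | hk
      · simp only [Function.update_self] at h2 ⊢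
        -- The entries before a final `M` satisfy `T k j + δ ≤ M`, which is the source of the new
        -- flag `M + 1 - δ`.
        have := hT.row k j n h1 h2 (by omega)
        omega
      · simp only [Function.update_of_ne hk] at h2 ⊢
        exact hT.lt k j h1 h2
    · intro k j j' h1 h2 h3
      beta_reduce
      rw [hbox T 0 k j' h3, hbox T 0 k j (h2.trans h3)]
      exact hT.row k j j' h1 h2 (h3.trans_le (hle k))
    · intro k k' j hk h1 h2 h3 h4
      beta_reduce
      rw [hbox T 0 k j h2, hbox T 0 k' j h4]
      exact hT.col k k' j hk h1 (h2.trans_le (hle k)) h3 (h4.trans_le (hle k'))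
  · rintro T ⟨hT, hTn⟩ T' ⟨hT', hTn'⟩ hTT
    funext k j
    have := congrFun (congrFun hTT k) j
    by_cases hk : k = i
    · subst hk
      by_cases hj : j = n
      · rw [hj, hTn, hTn']
      · simpa [hj] using this
    · simpa [hk] using this
  · intro T hT
    have hTn : T i n = 0 := hT.zero i n (by simp)
    refine ⟨Function.update T i (Function.update (T i) n M), ⟨⟨?_, ?_, ?_, ?_⟩, by simp⟩, ?_⟩
    · intro k j hj
      rcases eq_or_ne k i with rfl | hk
      · rw [Function.update_self, Function.update_of_ne (by rintro rfl; omega)]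
        exact hT.zero k j (by rw [Function.update_self]; omega)
      · rw [Function.update_of_ne hk]
        exact hT.zero k j (by rwa [Function.update_of_ne hk])
    · intro k j h1 h2
      have := hT.lt k j h1
      rcases eq_or_ne k i with rfl | hk
      · simp only [Function.update_self] at this ⊢
        by_cases hj : j = n
        · simp [hj, hm]
        · rw [Function.update_of_ne hj]
          have := this (by omega)
          omega
      · simp only [Function.update_of_ne hk] at this ⊢
        exact this h2
    · intro k j j' h1 h2 h3
      have hr := hT.row k j j' h1 h2
      have hl := hT.lt k j h1
      rcases eq_or_ne k i with rfl | hk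
      · simp only [Function.update_self] at hr hl ⊢
        rw [Function.update_of_ne (by omega : j ≠ n)]
        by_cases hj : j' = n
        · have := hl (by omega)
          rw [hj, Function.update_self]
          omega
        · rw [Function.update_of_ne hj]
          exact hr (by omega)
      · simp only [Function.update_of_ne hk] at hr ⊢
        exact hr h3
    · intro k k' j hk h1 h2 h3 h4
      have hc := hT.col k k' j hk h1
      have hl := hT.lt k j h1
      rcases eq_or_ne k i with rfl | hki
      -- No row below reaches column `n`, so the restored box has nothing under it.
      · have hjn : j ≠ n := by have := hgt k' hk; omega
        have hk' : k' ≠ k := hk.ne'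
        simp only [Function.update_self, Function.update_of_ne hk', Function.update_of_ne hjn]
          at hc ⊢
        exact hc (by omega) h3 h4
      · simp only [Function.update_of_ne hki] at hc hl ⊢
        rcases eq_or_ne k' i with rfl | hki'
        · simp only [Function.update_self] at hc ⊢
          by_cases hj : j = n
          -- An entry above the restored box is smaller than `m k ≤ M + δ`, which is exactly the
          -- column condition against `M`.
          · have := hlt k hk
            have := hl h2
            rw [hj, Function.update_self]
            subst hj
            omega
          · rw [Function.update_of_ne hj]
            exact hc h2 h3 (by omega)
        · simp only [Function.update_of_ne hki'] at hc ⊢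
          exact hc h2 h3 h4
    · funext k j
      rcases eq_or_ne k i with rfl | hk
      · by_cases hj : j = n
        · simp [hj, hTn]
        · simp [hj]
      · simp [hk]

/-- The last entry of a row is its maximum, so lowering the flag from `M + 1` to `M` only forbids
the value `M` there. -/
theorem isFlaggedFilling_update_iff (δ : ℕ) {r : ℕ} (μ ν m : Fin r → ℕ) (i : Fin r) (n M : ℕ)
    (hν : ν i = n + 1) (h : μ i ≤ n) (hm : m i = M + 1) (T : Fin r → ℕ → ℕ) :
    IsFlaggedFilling δ μ ν (Function.update m i M) T ↔
      IsFlaggedFilling δ μ ν m T ∧ T i n ≠ M := by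
  constructor
  · intro hT
    refine ⟨⟨hT.zero, fun k j h1 h2 => ?_, hT.row, hT.col⟩, ?_⟩
    · have := hT.lt k j h1 h2
      rcases eq_or_ne k i with rfl | hk
      · rw [Function.update_self] at this; omega
      · rwa [Function.update_of_ne hk] at this
    · have := hT.lt i n h (by omega)
      rw [Function.update_self] at this; omega
  · rintro ⟨hT, hTn⟩
    refine ⟨hT.zero, fun k j h1 h2 => ?_, hT.row, hT.col⟩
    have := hT.lt k j h1 h2
    rcases eq_or_ne k i with rfl | hk
    · rw [Function.update_self]
      have h3 := hT.lt k n h (by omega)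
      rcases eq_or_ne j n with rfl | hj
      · omega
      · have := hT.row k j n h1 (by omega) (by omega)
        omega
    · rwa [Function.update_of_ne hk]

theorem fillingSum_split (δ : ℕ) (w : ℕ → ℤ → R) {r : ℕ} (μ ν m : Fin r → ℕ)
    (i : Fin r) (n M : ℕ) (hν : ν i = n + 1) (h : μ i ≤ n) (hm : m i = M + 1) :
    fillingSum δ w μ ν m = fillingSum δ w μ ν (Function.update m i M) +
      ∑ᶠ T ∈ {T | IsFlaggedFilling δ μ ν m T ∧ T i n = M}, fillingWeight w μ ν T := by
  have hfin := finite_isFlaggedFilling δ μ ν m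
  unfold fillingSum
  rw [← finsum_mem_union]
  · refine finsum_mem_congr ?_ fun _ _ => rfl
    ext T
    simp only [Set.mem_union, Set.mem_ofPred_eq, isFlaggedFilling_update_iff δ μ ν m i n M hν h hm]
    tauto
  · rw [Set.disjoint_left]
    intro T h1 h2
    exact ((isFlaggedFilling_update_iff δ μ ν m i n M hν h hm T).1 h1).2 h2.2
  · exact finite_isFlaggedFilling _ _ _ _
  · exact hfin.subset fun T hT => hT.1

/-- The recurrence removing the last box of row `i`. -/
theorem fillingSum_recurrence (δ : ℕ) (hδ : δ ≤ 1) (w : ℕ → ℤ → R) {r : ℕ} (μ ν m : Fin r → ℕ)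
    (i : Fin r) (n M : ℕ) (hν : ν i = n + 1) (h : μ i ≤ n) (hm : m i = M + 1)
    (hlt : ∀ k < i, m k ≤ M + δ) (hgt : ∀ k, i < k → ν k ≤ n) :
    fillingSum δ w μ ν m = fillingSum δ w μ ν (Function.update m i M) +
      w M ((n : ℤ) - (i : ℕ)) *
        fillingSum δ w μ (Function.update ν i n) (Function.update m i (M + 1 - δ)) := by
  rw [fillingSum_split δ w μ ν m i n M hν h hm]
  congr 1
  unfold fillingSum
  rw [mul_finsum_mem' _ _ (finite_isFlaggedFilling _ _ _ _)]
  refine finsum_mem_eq_of_bijOn _ (bijOn_remove_box δ hδ μ ν m i n M hν h hm hlt hgt) ?_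
  rintro T ⟨-, hT⟩
  rw [fillingWeight_eq_mul w μ ν T i n hν h 0, hT]

/-- If the next row is as long as row `i`, no filling has a maximal entry at the end of row `i`. -/
theorem fillingSum_eq_of_blocked (δ : ℕ) (w : ℕ → ℤ → R) {r : ℕ} (μ ν m : Fin r → ℕ)
    (i k : Fin r) (n M : ℕ) (hν : ν i = n + 1) (h : μ i ≤ n) (hm : m i = M + 1)
    (hik : i < k) (hk : ν k = n + 1) (hμ : μ k ≤ n) (hmk : m k + δ ≤ M + 1) :
    fillingSum δ w μ ν m = fillingSum δ w μ ν (Function.update m i M) := by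
  rw [fillingSum_split δ w μ ν m i n M hν h hm]
  convert add_zero _
  convert finsum_mem_empty
  ext T
  simp only [Set.mem_ofPred_eq, Set.mem_empty_iff_false, iff_false, not_and]
  intro hT hTn
  have h1 := hT.col i k n hik h (by omega) hμ (by omega)
  have h2 := hT.lt k n hμ (by omega)
  omega

theorem fillingSum_zero (δ : ℕ) (w : ℕ → ℤ → R) {r : ℕ} (μ : Fin r → ℕ) (m : Fin r → ℕ) :
    fillingSum δ w μ μ m = 1 := by
  have : {T | IsFlaggedFilling δ μ μ m T} = {fun _ _ => 0} := by
    ext T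
    simp only [Set.mem_ofPred_eq, Set.mem_singleton_iff]
    constructor
    · intro hT
      funext i j
      exact hT.zero i j (by omega)
    · rintro rfl
      exact ⟨fun _ _ _ => rfl, fun i j _ _ => by omega, fun i j _ _ _ _ => by omega,
        fun i _ j _ _ _ _ _ => by omega⟩
  rw [fillingSum, this, finsum_mem_singleton]
  simp [fillingWeight]

theorem fillingSum_flag_zero (δ : ℕ) (w : ℕ → ℤ → R) {r : ℕ} (μ ν m : Fin r → ℕ) (i : Fin r)
    (h : μ i < ν i) (hm : m i = 0) : fillingSum δ w μ ν m = 0 := by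
  have : {T | IsFlaggedFilling δ μ ν m T} = ∅ := by
    ext T
    simp only [Set.mem_ofPred_eq, Set.mem_empty_iff_false, iff_false]
    intro hT
    have := hT.lt i (μ i) le_rfl h
    omega
  rw [fillingSum, this, finsum_mem_empty]

end Fillings

/-! ### The flagged Jacobi–Trudi determinant -/

section Determinants

open Finset

variable {R : Type*} [CommRing R]

/-- The generating function of the fillings with entries smaller than `m` of a row whose boxes have
the contents `a, a + 1, …, b - 1`; it is `0` for `b < a`. -/
noncomputable def rowSum (δ : ℕ) (w : ℕ → ℤ → R) (m : ℕ) (a b : ℤ) : R :=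
  if b < a then 0 else
    fillingSum δ (fun v k => w v (a + k)) (r := 1) (fun _ => 0) (fun _ => (b - a).toNat) fun _ => m

theorem rowSum_of_lt (δ : ℕ) (w : ℕ → ℤ → R) (m : ℕ) {a b : ℤ} (h : b < a) :
    rowSum δ w m a b = 0 := if_pos h

theorem rowSum_self (δ : ℕ) (w : ℕ → ℤ → R) (m : ℕ) (a : ℤ) : rowSum δ w m a a = 1 := by
  simp only [rowSum, lt_self_iff_false, if_false, sub_self, Int.toNat_zero]
  exact fillingSum_zero _ _ _ _

theorem rowSum_zero (δ : ℕ) (w : ℕ → ℤ → R) {a b : ℤ} (h : a ≠ b) : rowSum δ w 0 a b = 0 := by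
  unfold rowSum
  split_ifs with hab
  · rfl
  · exact fillingSum_flag_zero _ _ _ _ _ 0 (by omega) rfl

/-- The last entry is `M` or it is not. The convention for `b < a` keeps the recurrence valid for
all integers `a`, `b`, as needed for every entry of a matrix row. -/
theorem rowSum_succ (δ : ℕ) (hδ : δ ≤ 1) (w : ℕ → ℤ → R) (M : ℕ) (a b : ℤ) :
    rowSum δ w (M + 1) a b =
      rowSum δ w M a b + w M (b - 1) * rowSum δ w (M + 1 - δ) a (b - 1) := by
  rcases lt_trichotomy b a with h | rfl | h
  · simp [rowSum_of_lt, h, h.trans' (sub_one_lt b)]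
  · simp [rowSum_self, rowSum_of_lt]
  · obtain ⟨n, rfl⟩ : ∃ n : ℕ, b = a + n + 1 := ⟨(b - a - 1).toNat, by omega⟩
    have hc : ∀ x y : ℕ, Function.update (fun _ : Fin 1 => x) 0 y = fun _ => y := by
      intro x y
      funext k
      rw [Subsingleton.elim k 0, Function.update_self]
    have h1 : ((a + n + 1 - a).toNat) = n + 1 := by omega
    have h2 : ((a + n + 1 - 1 - a).toNat) = n := by omega
    rw [rowSum, rowSum, rowSum, if_neg (by omega), if_neg (by omega), if_neg (by omega), h1, h2,
      fillingSum_recurrence δ hδ _ _ (fun _ => n + 1) (fun _ => M + 1) (0 : Fin 1) n M rfl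
        (Nat.zero_le _) rfl (fun k hk => absurd hk (by simp)) (fun k hk => by omega), hc, hc, hc]
    congr 3
    simp

/-- The determinant of the Jacobi–Trudi matrix with flags `m`. -/
noncomputable def flaggedDet (δ : ℕ) (w : ℕ → ℤ → R) {r : ℕ} (a b : Fin r → ℤ) (m : Fin r → ℕ) : R :=
  (Matrix.of fun i j => rowSum δ w (m i) (a j) (b i)).det

/-- The coefficient `w M (b i - 1)` does not depend on the column, so row `i` is a sum of two rows
and the determinant is linear in it. In contrast to fillings, nothing is required of the other rows.
-/
theorem flaggedDet_recurrence (δ : ℕ) (hδ : δ ≤ 1) (w : ℕ → ℤ → R) {r : ℕ} (a b : Fin r → ℤ)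
    (m : Fin r → ℕ) (i : Fin r) (M : ℕ) (hm : m i = M + 1) :
    flaggedDet δ w a b m = flaggedDet δ w a b (Function.update m i M) +
      w M (b i - 1) * flaggedDet δ w a (Function.update b i (b i - 1))
        (Function.update m i (M + 1 - δ)) := by
  set A : Matrix (Fin r) (Fin r) R := Matrix.of fun i j => rowSum δ w (m i) (a j) (b i) with hA
  have h0 : A = A.updateRow i ((fun j => rowSum δ w M (a j) (b i)) +
      w M (b i - 1) • fun j => rowSum δ w (M + 1 - δ) (a j) (b i - 1)) := by
    ext k j
    rcases eq_or_ne k i with rfl | hk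
    · simp [hA, hm, rowSum_succ δ hδ w M]
    · simp [hk]
  have h1 : (Matrix.of fun k j => rowSum δ w (Function.update m i M k) (a j) (b k)) =
      A.updateRow i fun j => rowSum δ w M (a j) (b i) := by
    ext k j
    rcases eq_or_ne k i with rfl | hk
    · simp
    · simp [hk, hA]
  have h2 : (Matrix.of fun k j => rowSum δ w (Function.update m i (M + 1 - δ) k) (a j)
      (Function.update b i (b i - 1) k)) =
      A.updateRow i fun j => rowSum δ w (M + 1 - δ) (a j) (b i - 1) := by
    ext k j
    rcases eq_or_ne k i with rfl | hk
    · simp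
    · simp [hk, hA]
  rw [flaggedDet, flaggedDet, flaggedDet, h1, h2, ← hA, ← Matrix.det_updateRow_smul,
    ← Matrix.det_updateRow_add, ← h0]

theorem flaggedDet_eq_zero_of_eq (δ : ℕ) (w : ℕ → ℤ → R) {r : ℕ} (a b : Fin r → ℤ)
    (m : Fin r → ℕ) {i k : Fin r} (hik : i ≠ k) (hb : b i = b k) (hm : m i = m k) :
    flaggedDet δ w a b m = 0 :=
  Matrix.det_zero_of_row_eq hik (by ext j; simp [hb, hm])

/-- All entries in rows `≥ i` and columns `≤ i` vanish, and this block is too large for a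
permutation to avoid. -/
theorem flaggedDet_eq_zero_of_lt (δ : ℕ) (w : ℕ → ℤ → R) {r : ℕ} (a b : Fin r → ℤ)
    (m : Fin r → ℕ) (ha : Antitone a) (hb : Antitone b) (i : Fin r) (h : b i < a i) :
    flaggedDet δ w a b m = 0 := by
  rw [flaggedDet, Matrix.det_apply]
  refine sum_eq_zero fun σ _ => ?_
  obtain ⟨j, hj, hij⟩ : ∃ j ≤ i, i ≤ σ j := by
    by_contra! H
    -- Otherwise `σ` would inject the indices `≤ i` into those `< i`.
    have := card_le_card_of_injOn (s := Iic i) (t := Iio i) σ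
      (fun j hj => by simpa using H j (by simpa using hj)) σ.injective.injOn
    simp at this
  rw [prod_eq_zero (mem_univ j), smul_zero]
  exact rowSum_of_lt _ _ _ ((hb hij).trans_lt (h.trans_le (ha hj)))

theorem flaggedDet_flag_zero_self (δ : ℕ) (w : ℕ → ℤ → R) {r : ℕ} (a : Fin r → ℤ)
    (ha : StrictAnti a) : flaggedDet δ w a a (fun _ => 0) = 1 := by
  rw [flaggedDet, ← Matrix.det_one (n := Fin r)]
  congr 1
  ext i j
  rcases eq_or_ne i j with rfl | h
  · simp [rowSum_self]
  · simp [Matrix.one_apply_ne h, rowSum_zero _ _ (ha.injective.ne h.symm)]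

/-- In the first row `i` with `a i < b i`, the value `b i` lies strictly between `a i` and all
earlier `a j = b j`. It therefore equals no `a j`, and the row is zero. -/
theorem flaggedDet_flag_zero (δ : ℕ) (w : ℕ → ℤ → R) {r : ℕ} (a b : Fin r → ℤ)
    (ha : StrictAnti a) (hb : StrictAnti b) (hab : a ≤ b) (hne : a ≠ b) :
    flaggedDet δ w a b (fun _ => 0) = 0 := by
  obtain ⟨i, hi, hmin⟩ : ∃ i, a i ≠ b i ∧ ∀ j < i, a j = b j := by
    have hex : ∃ i, a i ≠ b i := Function.ne_iff.1 hne
    obtain ⟨i, hi, hmin⟩ := WellFounded.has_min (wellFounded_lt (α := Fin r)) {i | a i ≠ b i} hex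
    exact ⟨i, hi, fun j hj => by_contra fun h => hmin j h hj⟩
  refine Matrix.det_eq_zero_of_row_eq_zero i fun j => rowSum_zero _ _ ?_
  rcases lt_or_ge j i with hj | hj
  · rw [hmin j hj]
    exact (hb hj).ne'
  · exact ((ha.antitone hj).trans_lt (lt_of_le_of_ne (hab i) hi)).ne

theorem strictAnti_sub_index {r : ℕ} {ν : Fin r → ℕ} (hν : Antitone ν) :
    StrictAnti fun i => (ν i : ℤ) - (i : ℕ) := by
  intro i j hij
  have h1 := hν hij.le
  have h2 : (i : ℕ) < j := hij
  dsimp only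
  omega

/-- The flagged Jacobi–Trudi identity for the flag `m` follows from the one for the flag in which
`m i` is lowered by one. -/
theorem flaggedDet_eq_fillingSum_of_update (δ : ℕ) (hδ : δ ≤ 1) (w : ℕ → ℤ → R) {r : ℕ}
    (μ : Fin r → ℕ) (hμ : Antitone μ) (m : Fin r → ℕ) (i : Fin r) (M : ℕ) (hm : m i = M + 1)
    (hlt : ∀ k < i, m k = M + δ) (hgt : ∀ k, i < k → m k = M + 1 - δ)
    (H : ∀ ν : Fin r → ℕ, Antitone ν → μ ≤ ν →
      flaggedDet δ w (fun j => (μ j : ℤ) - (j : ℕ)) (fun k => (ν k : ℤ) - (k : ℕ))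
        (Function.update m i M) = fillingSum δ w μ ν (Function.update m i M))
    (ν : Fin r → ℕ) (hν : Antitone ν) (hle : μ ≤ ν) :
    flaggedDet δ w (fun j => (μ j : ℤ) - (j : ℕ)) (fun k => (ν k : ℤ) - (k : ℕ)) m =
      fillingSum δ w μ ν m := by
  obtain ⟨N, hN⟩ : ∃ N, N = ν i := ⟨_, rfl⟩
  induction N using Nat.strong_induction_on generalizing ν with
  | _ N ih =>
  subst hN
  rw [flaggedDet_recurrence δ hδ w _ _ m i M hm, H ν hν hle]
  have hlei : μ i ≤ ν i := hle i
  rcases hlei.eq_or_lt with hi | hi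
  -- Row `i` is empty, so its flag is irrelevant to fillings, while the extra determinant has `b i <
  -- a i`. Shortening keeps `b` weakly decreasing because `ν k - k` decreases strictly.
  · have hanti : Antitone (Function.update (fun k => (ν k : ℤ) - (k : ℕ)) i
        ((ν i : ℤ) - (i : ℕ) - 1)) := by
      intro k l hkl
      have h1 := (strictAnti_sub_index hν).antitone hkl
      rcases eq_or_ne l i with rfl | hli
      · rcases eq_or_ne k l with rfl | hkl'
        · exact le_rfl
        · simp only [Function.update_self, Function.update_of_ne hkl']
          exact (sub_one_lt _).le.trans h1
      · rcases eq_or_ne k i with rfl | hki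
        · have := strictAnti_sub_index hν (lt_of_le_of_ne hkl hli.symm)
          simp only [Function.update_self, Function.update_of_ne hli]
          exact Int.le_sub_one_of_lt this
        · simpa [hli, hki] using h1
    rw [fillingSum_update_of_eq _ _ _ _ _ _ hi.symm, flaggedDet_eq_zero_of_lt _ _ _ _ _
      (strictAnti_sub_index hμ).antitone hanti i (by simp [hi]), mul_zero, add_zero]
  obtain ⟨n, hn⟩ : ∃ n, ν i = n + 1 := ⟨ν i - 1, by omega⟩
  by_cases hk : ∃ k, i < k ∧ n < ν k
  · obtain ⟨k, hik, hk⟩ := hk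
    -- The next row is as long as row `i`, so the box is not removable. Lowering `b i` by one makes
    -- it equal to `b l`, and both flags are then `M + 1 - δ`: two rows of the extra determinant
    -- coincide.
    let l : Fin r := ⟨i + 1, lt_of_le_of_lt (Nat.succ_le_of_lt hik) k.2⟩
    have hil : i < l := Fin.lt_def.2 (Nat.lt_succ_self _)
    have hl : ν l = n + 1 := by
      have h1 : ν k ≤ ν l := hν (Fin.le_def.2 (Nat.succ_le_of_lt hik))
      have h2 := hν hil.le
      omega
    have hμl : μ l ≤ n := by
      have := hμ hil.le
      omega
    have hml := hgt l hil
    rw [fillingSum_eq_of_blocked δ w μ ν m i l n M hn (by omega) hm hil hl hμl (by omega),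
      flaggedDet_eq_zero_of_eq δ w _ _ _ hil.ne, mul_zero, add_zero]
    · rw [Function.update_self, Function.update_of_ne hil.ne', hn, hl]
      simp only [l]
      push_cast
      ring
    · rw [Function.update_self, Function.update_of_ne hil.ne', hml]
  push Not at hk
  rw [fillingSum_recurrence δ hδ w μ ν m i n M hn (by omega) hm (fun k hk => (hlt k hk).le) hk]
  have hb : Function.update (fun k => (ν k : ℤ) - (k : ℕ)) i ((ν i : ℤ) - (i : ℕ) - 1) =
      fun k => (Function.update ν i n k : ℤ) - (k : ℕ) := by
    funext k
    rcases eq_or_ne k i with rfl | hki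
    · simp only [Function.update_self, hn]
      push_cast
      ring
    · simp only [Function.update_of_ne hki]
  have hν' : Antitone (Function.update ν i n) := by
    intro k l hkl
    have h1 := hν hkl
    rcases eq_or_ne k i with rfl | hki
    · rcases eq_or_ne l k with rfl | hlk
      · exact le_rfl
      · simpa [hlk] using hk l (lt_of_le_of_ne hkl hlk.symm)
    · rcases eq_or_ne l i with rfl | hli
      · simp only [Function.update_self, Function.update_of_ne hki]
        omega
      · simpa [hli, hki] using h1
  have hle' : μ ≤ Function.update ν i n := by
    intro k
    rcases eq_or_ne k i with rfl | hki
    · rw [Function.update_self]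
      exact Nat.le_of_lt_succ (hi.trans_eq hn)
    · simpa [hki] using hle k
  have hrec : flaggedDet δ w (fun j => (μ j : ℤ) - (j : ℕ))
      (fun k => (Function.update ν i n k : ℤ) - (k : ℕ)) (Function.update m i (M + 1 - δ)) =
      fillingSum δ w μ (Function.update ν i n) (Function.update m i (M + 1 - δ)) := by
    -- For `δ = 0` the flag is unchanged and the induction on the length of row `i` applies; for `δ
    -- = 1` the flag drops to `M`, which is the case `H`.
    interval_cases δ
    · have : Function.update m i (M + 1 - 0) = m := by
        rw [Nat.sub_zero, ← hm, Function.update_eq_self]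
      rw [this]
      exact ih n (by omega) _ hν' hle' (by simp)
    · exact H _ hν' hle'
  rw [hb, hrec, hn]
  congr 3
  push_cast
  ring

/-- For `δ = 0` the flag `M` is raised to `M + 1` in the rows `p, p + 1, …` -/
theorem flaggedDet_eq_fillingSum_raise_last (w : ℕ → ℤ → R) {r : ℕ}
    (μ : Fin r → ℕ) (hμ : Antitone μ) (M : ℕ)
    (H : ∀ ν : Fin r → ℕ, Antitone ν → μ ≤ ν →
      flaggedDet 0 w (fun j => (μ j : ℤ) - (j : ℕ)) (fun k => (ν k : ℤ) - (k : ℕ))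
        (fun _ => M) = fillingSum 0 w μ ν fun _ => M) (p : ℕ) (hp : p ≤ r) :
    ∀ ν : Fin r → ℕ, Antitone ν → μ ≤ ν →
      flaggedDet 0 w (fun j => (μ j : ℤ) - (j : ℕ)) (fun k => (ν k : ℤ) - (k : ℕ))
        (fun k : Fin r => if (k : ℕ) < p then M else M + 1) =
      fillingSum 0 w μ ν fun k : Fin r => if (k : ℕ) < p then M else M + 1 := by
  -- Raising a row requires flag `M` above it and `M + 1` below it, so rows are treated from the
  -- bottom up.
  induction hp using Nat.decreasingInduction with
  | self => simpa using H
  | of_succ p hp ih =>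
    refine flaggedDet_eq_fillingSum_of_update 0 zero_le_one w μ hμ _ ⟨p, hp⟩ M (by simp)
      (fun k hk => if_pos (Fin.lt_def.1 hk))
      (fun k hk => if_neg (Fin.lt_def.1 hk).le.not_gt) ?_
    have : Function.update (fun k : Fin r => if (k : ℕ) < p then M else M + 1) ⟨p, hp⟩ M =
        fun k : Fin r => if (k : ℕ) < p + 1 then M else M + 1 := by
      funext k
      rcases eq_or_ne k ⟨p, hp⟩ with rfl | hk
      · simp
      · have : (k : ℕ) ≠ p := fun h => hk (Fin.ext h)
        rw [Function.update_of_ne hk]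
        exact if_congr (by omega) rfl rfl
    rwa [this]

/-- For `δ = 1` the flag `M` is raised to `M + 1` in the first `p` rows. -/
theorem flaggedDet_eq_fillingSum_raise_first (w : ℕ → ℤ → R) {r : ℕ}
    (μ : Fin r → ℕ) (hμ : Antitone μ) (M : ℕ)
    (H : ∀ ν : Fin r → ℕ, Antitone ν → μ ≤ ν →
      flaggedDet 1 w (fun j => (μ j : ℤ) - (j : ℕ)) (fun k => (ν k : ℤ) - (k : ℕ))
        (fun _ => M) = fillingSum 1 w μ ν fun _ => M) (p : ℕ) (hp : p ≤ r) :
    ∀ ν : Fin r → ℕ, Antitone ν → μ ≤ ν →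
      flaggedDet 1 w (fun j => (μ j : ℤ) - (j : ℕ)) (fun k => (ν k : ℤ) - (k : ℕ))
        (fun k : Fin r => if (k : ℕ) < p then M + 1 else M) =
      fillingSum 1 w μ ν fun k : Fin r => if (k : ℕ) < p then M + 1 else M := by
  -- Here the requirement is `M + 1` above and `M` below, so rows are treated from the top down.
  induction p with
  | zero => simpa using H
  | succ p ih =>
    refine flaggedDet_eq_fillingSum_of_update 1 le_rfl w μ hμ _ ⟨p, hp⟩ M (by simp)
      (fun k hk => if_pos ((Fin.lt_def.1 hk).trans (Nat.lt_succ_self p)))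
      (fun k hk => if_neg (not_lt.2 (Fin.lt_def.1 hk))) ?_
    have : Function.update (fun k : Fin r => if (k : ℕ) < p + 1 then M + 1 else M) ⟨p, hp⟩ M =
        fun k : Fin r => if (k : ℕ) < p then M + 1 else M := by
      funext k
      rcases eq_or_ne k ⟨p, hp⟩ with rfl | hk
      · simp
      · have : (k : ℕ) ≠ p := fun h => hk (Fin.ext h)
        rw [Function.update_of_ne hk]
        exact if_congr (by omega) rfl rfl
    rw [this]
    exact ih (Nat.le_of_succ_le hp)

/-- The Jacobi–Trudi identity for finitely many variables and arbitrary weights. -/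
theorem det_rowSum_eq_fillingSum (δ : ℕ) (hδ : δ ≤ 1) (w : ℕ → ℤ → R) {r : ℕ}
    (μ ν : Fin r → ℕ) (hμ : Antitone μ) (hν : Antitone ν) (hle : μ ≤ ν) (M : ℕ) :
    (Matrix.of fun i j : Fin r =>
      rowSum δ w M ((μ j : ℤ) - (j : ℕ)) ((ν i : ℤ) - (i : ℕ))).det =
      fillingSum δ w μ ν fun _ => M := by
  change flaggedDet δ w (fun j => (μ j : ℤ) - (j : ℕ)) (fun k => (ν k : ℤ) - (k : ℕ)) _ = _
  induction M generalizing ν with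
  | zero =>
    rcases eq_or_ne μ ν with rfl | hne
    · rw [flaggedDet_flag_zero_self _ _ _ (strictAnti_sub_index hμ), fillingSum_zero]
    · obtain ⟨i, hi⟩ := Function.ne_iff.1 hne
      rw [fillingSum_flag_zero δ w μ ν _ i (lt_of_le_of_ne (hle i) hi) rfl,
        flaggedDet_flag_zero _ _ _ _ (strictAnti_sub_index hμ) (strictAnti_sub_index hν)]
      · intro k
        have : μ k ≤ ν k := hle k
        dsimp only
        omega
      · intro h
        have := congrFun h i
        omega
  | succ M ih =>
    interval_cases δ
    · simpa using flaggedDet_eq_fillingSum_raise_last w μ hμ M (fun ν hν hle => ih ν hν hle) 0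
        (Nat.zero_le r) ν hν hle
    · simpa using flaggedDet_eq_fillingSum_raise_first w μ hμ M (fun ν hν hle => ih ν hν hle) r
        le_rfl ν hν hle

end Determinants

/-! ### Passage to infinitely many variables -/

section Limits

open Finset Filter Topology
open scoped MvPowerSeries.WithPiTopology

theorem finite_bounded {ι : Type} [Fintype ι] (P : (ι → ℕ+) → Prop) (M : ℕ) :
    {m : {m : ι → ℕ+ // P m} | ∀ x, (m.1 x : ℕ) ≤ M}.Finite := by
  have h1 : {k : ℕ+ | (k : ℕ) ≤ M}.Finite :=
    (Set.finite_Iic M).preimage PNat.coe_injective.injOn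
  have h2 : (Set.pi Set.univ fun _ : ι => {k : ℕ+ | (k : ℕ) ≤ M}).Finite := Set.Finite.pi fun _ => h1
  exact (h2.preimage Subtype.val_injective.injOn).subset fun m hm x _ => hm x

/-- A sum over maps with values in `ℕ+` is the limit of the sums over the bounded maps. -/
theorem tendsto_finsum_bounded {ι : Type} [Fintype ι] (P : (ι → ℕ+) → Prop)
    (f : {m : ι → ℕ+ // P m} → PSeries) (hf : Summable f) :
    Tendsto (fun M : ℕ => ∑ᶠ m ∈ {m : {m : ι → ℕ+ // P m} | ∀ x, (m.1 x : ℕ) ≤ M}, f m) atTop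
      (𝓝 (∑' m, f m)) := by
  have h : ∀ M : ℕ, ∑ᶠ m ∈ {m : {m : ι → ℕ+ // P m} | ∀ x, (m.1 x : ℕ) ≤ M}, f m =
      ∑ m ∈ (finite_bounded P M).toFinset, f m := fun M =>
    finsum_mem_eq_finite_toFinset_sum _ _
  simp only [h]
  refine hf.hasSum.comp (tendsto_atTop_finset_of_monotone ?_ ?_)
  · intro M N hMN m hm
    simp only [Set.Finite.mem_toFinset, Set.mem_ofPred_eq] at hm ⊢
    exact fun x => (hm x).trans hMN
  · intro m
    -- The sum of all values bounds each of them.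
    refine ⟨∑ x, (m.1 x : ℕ), ?_⟩
    simp only [Set.Finite.mem_toFinset, Set.mem_ofPred_eq]
    exact fun x => single_le_sum (f := fun x => (m.1 x : ℕ)) (fun _ _ => Nat.zero_le _) (mem_univ x)

/-- Reading the boxes of `ν/μ` off an indexing `e`, the sum over all maps `m` satisfying the
conditions of a filling is the limit of the sums over the bounded fillings. -/
theorem tendsto_fillingSum {ι : Type} [Fintype ι] (P : (ι → ℕ+) → Prop) (γ : ι → ℕ+)
    (δ : ℕ) {r : ℕ} (μ ν : Fin r → ℕ) (e : ι → Fin r × ℕ) (he : Function.Injective e)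
    (hrange : ∀ i j, (∃ x, e x = (i, j)) ↔ μ i ≤ j ∧ j < ν i)
    (hP : ∀ m, P m ↔
      (∀ x y, (e x).1 = (e y).1 → (e x).2 < (e y).2 → (m x : ℕ) + δ ≤ m y) ∧
      (∀ x y, (e x).1 < (e y).1 → (e x).2 = (e y).2 → (m x : ℕ) + 1 ≤ m y + δ))
    (g : ℤ → ℕ) (hg : ∀ x, (γ x : ℕ) = g (((e x).2 : ℤ) - ((e x).1 : ℕ))) :
    Tendsto (fun M : ℕ =>
        fillingSum δ (fun v k => (MvPowerSeries.X v.succPNat ^ g k : PSeries)) μ ν fun _ => M) atTop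
      (𝓝 (∑' m : {m : ι → ℕ+ // P m}, ∏ x, MvPowerSeries.X (m.1 x) ^ (γ x : ℕ))) := by
  have hbox : ∀ x, μ (e x).1 ≤ (e x).2 ∧ (e x).2 < ν (e x).1 := fun x => (hrange _ _).1 ⟨x, rfl⟩
  refine (tendsto_finsum_bounded P _ (summable_monomials P γ)).congr fun M => ?_
  -- Values are shifted down by one, so that `≤ M` for positive integers becomes `< M` for entries
  -- of fillings.
  let F : {m : ι → ℕ+ // P m} → Fin r → ℕ → ℕ := fun m i j =>
    Function.extend e (fun x => (m.1 x).natPred) 0 (i, j)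
  have hF : ∀ m x, F m (e x).1 (e x).2 = (m.1 x).natPred := fun m x => he.extend_apply _ _ x
  have hF1 : ∀ m x, F m (e x).1 (e x).2 + 1 = m.1 x := fun m x => by
    rw [hF, PNat.natPred_add_one]
  refine finsum_mem_eq_of_bijOn F ⟨?_, ?_, ?_⟩ ?_
  · intro m hm
    have hPm := (hP m.1).1 m.2
    refine ⟨?_, ?_, ?_, ?_⟩
    · intro i j hij
      exact Function.extend_apply' _ _ _ (fun h => hij ((hrange i j).1 h))
    · intro i j h1 h2
      obtain ⟨x, hx⟩ := (hrange i j).2 ⟨h1, h2⟩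
      have := hF1 m x
      have := hm x
      rw [hx] at *
      dsimp only at *
      omega
    · intro i j j' h1 h2 h3
      obtain ⟨x, hx⟩ := (hrange i j).2 ⟨h1, h2.trans h3⟩
      obtain ⟨y, hy⟩ := (hrange i j').2 ⟨h1.trans h2.le, h3⟩
      have h4 := hF1 m x
      have h5 := hF1 m y
      have h6 := hPm.1 x y
      simp only [hx, hy, forall_const] at h4 h5 h6
      have := h6 h2
      omega
    · intro i i' j hi h1 h2 h3 h4
      obtain ⟨x, hx⟩ := (hrange i j).2 ⟨h1, h2⟩
      obtain ⟨y, hy⟩ := (hrange i' j).2 ⟨h3, h4⟩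
      have h5 := hF1 m x
      have h6 := hF1 m y
      have h7 := hPm.2 x y
      simp only [hx, hy, forall_const] at h5 h6 h7
      have := h7 hi
      omega
  · intro m _ m' _ h
    refine Subtype.ext (funext fun x => PNat.coe_injective ?_)
    rw [← hF1, ← hF1, h]
  · intro T hT
    have hPT : P fun x => (T (e x).1 (e x).2).succPNat := by
      refine (hP _).2 ⟨?_, ?_⟩
      · intro x y h1 h2
        have := hT.row (e x).1 (e x).2 (e y).2 (hbox x).1 h2 (h1 ▸ (hbox y).2)
        rw [← h1]
        simp only [Nat.succPNat_coe]
        omega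
      · intro x y h1 h2
        have := hT.col (e x).1 (e y).1 (e x).2 h1 (hbox x).1 (hbox x).2 (h2 ▸ (hbox y).1)
          (h2 ▸ (hbox y).2)
        rw [← h2]
        simp only [Nat.succPNat_coe]
        omega
    refine ⟨⟨_, hPT⟩, ?_, ?_⟩
    · intro x
      have := hT.lt (e x).1 (e x).2 (hbox x).1 (hbox x).2
      simp only [Nat.succPNat_coe]
      omega
    · funext i j
      by_cases h : ∃ x, e x = (i, j)
      · obtain ⟨x, hx⟩ := h
        have := hF ⟨_, hPT⟩ x
        rw [hx] at this
        simpa [hx] using this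
      · rw [hT.zero i j (fun h' => h ((hrange i j).2 h'))]
        exact Function.extend_apply' _ _ _ h
  · intro m _
    rw [fillingWeight, prod_sigma']
    refine prod_bij (fun x _ => ⟨(e x).1, (e x).2⟩) ?_ ?_ ?_ ?_
    · intro x _
      simpa using hbox x
    · intro x _ y _ h
      refine he (Prod.ext ?_ ?_)
      · exact congrArg Sigma.fst h
      · simpa using congrArg (fun z : (_ : Fin r) × ℕ => z.2) h
    · rintro ⟨i, j⟩ hij
      obtain ⟨x, hx⟩ := (hrange i j).2 (by simpa using hij)
      exact ⟨x, mem_univ x, by rw [hx]⟩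
    · intro x _
      dsimp only
      rw [hg, hF, PNat.succPNat_natPred]

theorem tendsto_rowSum_essentialEntry (c : ℤ → ℕ+) (a b : ℤ) :
    Tendsto (fun M : ℕ =>
        rowSum 0 (fun v k => (MvPowerSeries.X v.succPNat ^ (c k : ℕ) : PSeries)) M a b) atTop
      (𝓝 (essentialEntry c a (b - a))) := by
  unfold rowSum essentialEntry
  by_cases h : b < a
  · rw [if_pos (by omega)]
    simp only [if_pos h]
    exact tendsto_const_nhds
  rw [if_neg (by omega)]
  simp only [if_neg h]
  refine tendsto_fillingSum _ _ 0 (r := 1) _ _ (fun k : Fin (b - a).toNat => (0, (k : ℕ)))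
    ?_ ?_ ?_ (fun k => (c (a + k) : ℕ)) ?_
  · exact fun x y h => Fin.ext (congrArg Prod.snd h)
  · intro i j
    constructor
    · rintro ⟨x, hx⟩
      simp only [Prod.mk.injEq] at hx
      exact ⟨Nat.zero_le _, hx.2 ▸ x.2⟩
    · rintro ⟨-, hj⟩
      exact ⟨⟨j, hj⟩, by simp [Subsingleton.elim i 0]⟩
  · intro m
    simp [monotone_iff_forall_lt]
  · intro x
    simp

/-- The row stands for a transposed column: its contents `a, a + 1, …` are the negatives of the true
ones, so `c` is read downwards from `-a`. -/
theorem tendsto_rowSum_monomialEntry (c : ℤ → ℕ+) (a b : ℤ) :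
    Tendsto (fun M : ℕ =>
        rowSum 1 (fun v k => (MvPowerSeries.X v.succPNat ^ (c (-k) : ℕ) : PSeries)) M a b) atTop
      (𝓝 (monomialEntry c (-a) (b - a))) := by
  unfold rowSum monomialEntry
  by_cases h : b < a
  · rw [if_pos (by omega)]
    simp only [if_pos h]
    exact tendsto_const_nhds
  rw [if_neg (by omega)]
  simp only [if_neg h]
  refine tendsto_fillingSum _ _ 1 (r := 1) _ _ (fun k : Fin (b - a).toNat => (0, (k : ℕ)))
    ?_ ?_ ?_ (fun k => (c (-(a + k)) : ℕ)) ?_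
  · exact fun x y h => Fin.ext (congrArg Prod.snd h)
  · intro i j
    constructor
    · rintro ⟨x, hx⟩
      simp only [Prod.mk.injEq] at hx
      exact ⟨Nat.zero_le _, hx.2 ▸ x.2⟩
    · rintro ⟨-, hj⟩
      exact ⟨⟨j, hj⟩, by simp [Subsingleton.elim i 0]⟩
  · intro m
    simp [StrictMono]
  · intro x
    simp [sub_eq_add_neg, add_comm]

theorem tendsto_fillingSum_rows (r : ℕ) (lam mu : YoungDiagram) (hr : lam.colLen 0 ≤ r)
    (γ : SkewTableau lam mu ℕ+) (c : ℤ → ℕ+) (hc : ∀ x, γ x = c (content x.1)) :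
    Tendsto (fun M : ℕ =>
        fillingSum 0 (fun v k => (MvPowerSeries.X v.succPNat ^ (c k : ℕ) : PSeries))
          (fun i : Fin r => mu.rowLen i) (fun i => lam.rowLen i) fun _ => M) atTop
      (𝓝 (schurQSym lam mu γ)) := by
  have hrow : ∀ x ∈ skewCells lam mu, x.1 < r := by
    intro x hx
    have h1 : x ∈ lam := (Finset.mem_sdiff.1 hx).1
    have h2 : (x.1, 0) ∈ lam := lam.up_left_mem le_rfl (Nat.zero_le _) h1
    exact (YoungDiagram.mem_iff_lt_colLen.1 h2).trans_le hr
  refine tendsto_fillingSum _ γ 0 _ _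
    (fun x : {x : ℕ × ℕ // x ∈ skewCells lam mu} => (⟨x.1.1, hrow x.1 x.2⟩, x.1.2))
    ?_ ?_ ?_ (fun k => (c k : ℕ)) ?_
  · intro x y h
    simp only [Prod.mk.injEq, Fin.mk.injEq] at h
    exact Subtype.ext (Prod.ext h.1 h.2)
  · intro i j
    have hmem : ((i : ℕ), j) ∈ skewCells lam mu ↔ mu.rowLen i ≤ j ∧ j < lam.rowLen i := by
      simp only [skewCells, Finset.mem_sdiff, YoungDiagram.mem_cells, YoungDiagram.mem_iff_lt_rowLen,
        not_lt]
      exact and_comm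
    rw [← hmem]
    constructor
    · rintro ⟨x, hx⟩
      simp only [Prod.mk.injEq] at hx
      rw [← hx.1, ← hx.2]
      exact x.2
    · intro h
      exact ⟨⟨_, h⟩, rfl⟩
  · intro T
    simp only [Fin.mk.injEq, Fin.mk_lt_mk, add_zero, PNat.coe_le_coe, Nat.succ_le_iff,
      PNat.coe_lt_coe]
    -- Semistandardness also compares a box with itself; those instances are trivial, so strict
    -- inequality of positions suffices.
    refine and_congr ⟨fun h x y h1 h2 => h x y h1 h2.le, fun h x y h1 h2 => ?_⟩
      ⟨fun h x y h1 h2 => h x y h2 h1, fun h x y h1 h2 => h x y h2 h1⟩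
    rcases h2.eq_or_lt with h3 | h3
    · rw [Subtype.ext (Prod.ext h1 h3)]
    · exact h x y h1 h3
  · intro x
    rw [hc]
    rfl

/-- Columns of `λ/μ` play the role of rows. This makes rows strict and columns weak, hence `δ = 1`,
and replaces the content `k` by `-k`. -/
theorem tendsto_fillingSum_columns (s : ℕ) (lam mu : YoungDiagram) (hs : lam.rowLen 0 ≤ s)
    (γ : SkewTableau lam mu ℕ+) (c : ℤ → ℕ+) (hc : ∀ x, γ x = c (content x.1)) :
    Tendsto (fun M : ℕ =>
        fillingSum 1 (fun v k => (MvPowerSeries.X v.succPNat ^ (c (-k) : ℕ) : PSeries))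
          (fun i : Fin s => mu.colLen i) (fun i => lam.colLen i) fun _ => M) atTop
      (𝓝 (schurQSym lam mu γ)) := by
  have hcol : ∀ x ∈ skewCells lam mu, x.2 < s := by
    intro x hx
    have h1 : x ∈ lam := (Finset.mem_sdiff.1 hx).1
    have h2 : (0, x.2) ∈ lam := lam.up_left_mem (Nat.zero_le _) le_rfl h1
    exact (YoungDiagram.mem_iff_lt_rowLen.1 h2).trans_le hs
  refine tendsto_fillingSum _ γ 1 _ _
    (fun x : {x : ℕ × ℕ // x ∈ skewCells lam mu} => (⟨x.1.2, hcol x.1 x.2⟩, x.1.1))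
    ?_ ?_ ?_ (fun k => (c (-k) : ℕ)) ?_
  · intro x y h
    simp only [Prod.mk.injEq, Fin.mk.injEq] at h
    exact Subtype.ext (Prod.ext h.2 h.1)
  · intro i j
    have hmem : (j, (i : ℕ)) ∈ skewCells lam mu ↔ mu.colLen i ≤ j ∧ j < lam.colLen i := by
      simp only [skewCells, Finset.mem_sdiff, YoungDiagram.mem_cells, YoungDiagram.mem_iff_lt_colLen,
        not_lt]
      exact and_comm
    rw [← hmem]
    constructor
    · rintro ⟨x, hx⟩
      simp only [Prod.mk.injEq] at hx
      rw [← hx.1, ← hx.2]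
      exact x.2
    · intro h
      exact ⟨⟨_, h⟩, rfl⟩
  · intro T
    simp only [Fin.mk.injEq, Fin.mk_lt_mk, add_le_add_iff_right, PNat.coe_le_coe,
      Nat.succ_le_iff, PNat.coe_lt_coe]
    refine and_comm.trans (and_congr Iff.rfl
      ⟨fun h x y h1 h2 => h x y h2 h1.le, fun h x y h1 h2 => ?_⟩)
    rcases h2.eq_or_lt with h3 | h3
    · rw [Subtype.ext (Prod.ext h1 h3)]
    · exact h x y h3 h1
  · intro x
    rw [hc]
    simp [content]

end Limits

/-! ### The Jacobi–Trudi formulas -/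

section JacobiTrudi

open Filter Topology
open scoped MvPowerSeries.WithPiTopology

theorem rowLen_mono {mu lam : YoungDiagram} (h : mu ≤ lam) (i : ℕ) : mu.rowLen i ≤ lam.rowLen i := by
  by_contra! hlt
  exact lt_irrefl _ (YoungDiagram.mem_iff_lt_rowLen.1 (h (YoungDiagram.mem_iff_lt_rowLen.2 hlt)))

theorem colLen_mono {mu lam : YoungDiagram} (h : mu ≤ lam) (i : ℕ) : mu.colLen i ≤ lam.colLen i := by
  by_contra! hlt
  exact lt_irrefl _ (YoungDiagram.mem_iff_lt_colLen.1 (h (YoungDiagram.mem_iff_lt_colLen.2 hlt)))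

/-- The Jacobi–Trudi formula for `S_{λ/μ}(γ)` in terms of the functions `E`. -/
theorem schurQSym_eq_det_essentialEntry (r : ℕ) (lam mu : YoungDiagram) (hmu : mu ≤ lam)
    (hr : lam.colLen 0 ≤ r) (γ : SkewTableau lam mu ℕ+)
    (c : ℤ → ℕ+) (hc : ∀ x, γ x = c (content x.1)) :
    schurQSym lam mu γ = (Matrix.of fun i j : Fin r => essentialEntry c ((mu.rowLen j : ℤ) - (j : ℕ))
      ((lam.rowLen i : ℤ) - (mu.rowLen j : ℤ) - (i : ℕ) + (j : ℕ))).det := by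
  have h : Tendsto (fun M : ℕ => (Matrix.of fun i j : Fin r =>
      rowSum 0 (fun v k => (MvPowerSeries.X v.succPNat ^ (c k : ℕ) : PSeries)) M
        ((mu.rowLen j : ℤ) - (j : ℕ)) ((lam.rowLen i : ℤ) - (i : ℕ))).det) atTop
      (𝓝 (Matrix.of fun i j : Fin r => essentialEntry c ((mu.rowLen j : ℤ) - (j : ℕ))
          ((lam.rowLen i : ℤ) - (mu.rowLen j : ℤ) - (i : ℕ) + (j : ℕ))).det) := by
    -- The determinant is polynomial in the entries, hence continuous for coefficientwise
    -- convergence, and entrywise limits suffice.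
    refine ((Continuous.matrix_det continuous_id).tendsto _).comp
      (tendsto_pi_nhds.2 fun i => tendsto_pi_nhds.2 fun j => ?_)
    convert tendsto_rowSum_essentialEntry c ((mu.rowLen j : ℤ) - (j : ℕ))
      ((lam.rowLen i : ℤ) - (i : ℕ)) using 2
    · rfl
    · exact congrArg₂ (essentialEntry c) (by ring) (by ring)
  refine tendsto_nhds_unique (tendsto_fillingSum_rows r lam mu hr γ c hc) (h.congr fun M => ?_)
  exact det_rowSum_eq_fillingSum 0 zero_le_one _ _ _
    (fun i j hij => mu.rowLen_anti _ _ hij) (fun i j hij => lam.rowLen_anti _ _ hij)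
    (fun i => rowLen_mono hmu i) M

/-- The Jacobi–Trudi formula for `S_{λ/μ}(γ)` in terms of the functions `M`. -/
theorem schurQSym_eq_det_monomialEntry (s : ℕ) (lam mu : YoungDiagram) (hmu : mu ≤ lam)
    (hs : lam.rowLen 0 ≤ s) (γ : SkewTableau lam mu ℕ+)
    (c : ℤ → ℕ+) (hc : ∀ x, γ x = c (content x.1)) :
    schurQSym lam mu γ = (Matrix.of fun i j : Fin s => monomialEntry c (-(mu.colLen j : ℤ) + (j : ℕ))
      ((lam.colLen i : ℤ) - (mu.colLen j : ℤ) - (i : ℕ) + (j : ℕ))).det := by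
  have h : Tendsto (fun M : ℕ => (Matrix.of fun i j : Fin s =>
      rowSum 1 (fun v k => (MvPowerSeries.X v.succPNat ^ (c (-k) : ℕ) : PSeries)) M
        ((mu.colLen j : ℤ) - (j : ℕ)) ((lam.colLen i : ℤ) - (i : ℕ))).det) atTop
      (𝓝 (Matrix.of fun i j : Fin s => monomialEntry c (-(mu.colLen j : ℤ) + (j : ℕ))
          ((lam.colLen i : ℤ) - (mu.colLen j : ℤ) - (i : ℕ) + (j : ℕ))).det) := by
    refine ((Continuous.matrix_det continuous_id).tendsto _).comp
      (tendsto_pi_nhds.2 fun i => tendsto_pi_nhds.2 fun j => ?_)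
    convert tendsto_rowSum_monomialEntry c ((mu.colLen j : ℤ) - (j : ℕ))
      ((lam.colLen i : ℤ) - (i : ℕ)) using 2
    · rfl
    · exact congrArg₂ (monomialEntry c) (by ring) (by ring)
  refine tendsto_nhds_unique (tendsto_fillingSum_columns s lam mu hs γ c hc) (h.congr fun M => ?_)
  exact det_rowSum_eq_fillingSum 1 le_rfl _ _ _
    (fun i j hij => mu.colLen_anti _ _ hij) (fun i j hij => lam.colLen_anti _ _ hij)
    (fun i => colLen_mono hmu i) M

end JacobiTrudi

/-- Jacobi–Trudi formulas for Schur type quasi-symmetric functions. Here `λ_{i+1} = lam.rowLen i` and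
`λ'_{i+1} = lam.colLen i`; passing to indices `i, j` counted from `0` turns `μ_j - j + 1` into
`μ_j - j` and `-μ'_j + j - 1` into `-μ'_j + j`, and leaves `λ_i - μ_j - i + j` unchanged. -/
theorem mainTheorem5 (r s : ℕ) (lam mu : YoungDiagram) (hmu : mu ≤ lam)
    (hr : lam.colLen 0 ≤ r) (hs : lam.rowLen 0 ≤ s)
    (γ : SkewTableau lam mu ℕ+) (hγ : γ.IsDiagonal)
    (c : ℤ → ℕ+) (hc : ∀ x, γ x = c (content x.1)) :
    schurQSym lam mu γ =
      (Matrix.of fun i j : Fin r =>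
        essentialEntry c ((mu.rowLen j : ℤ) - (j : ℕ))
          ((lam.rowLen i : ℤ) - (mu.rowLen j : ℤ) - (i : ℕ) + (j : ℕ))).det ∧
    schurQSym lam mu γ =
      (Matrix.of fun i j : Fin s =>
        monomialEntry c (-(mu.colLen j : ℤ) + (j : ℕ))
          ((lam.colLen i : ℤ) - (mu.colLen j : ℤ) - (i : ℕ) + (j : ℕ))).det := by
  exact ⟨schurQSym_eq_det_essentialEntry r lam mu hmu hr γ c hc,
    schurQSym_eq_det_monomialEntry s lam mu hmu hs γ c hc⟩
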